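/- **Setting.** Let $a_1,\dots,a_n\in\mathbb R^2$ ($n\ge 1$) be pairwise distinct, $F=\{a_1,\dots,a_n\}$, let $D\subset\mathbb R^2$ be a convex compact polygon with nonempty interior, let $u_d$ be a nonnegative measure on $D$ that is absolutely continuous with respect to Lebesgue measure, with a density that is continuous on $D$, let $\alpha>0$, and let $g\in C^2(\mathbb R^n)$. A vector $v\in\mathbb R^n$ is identified with the signed measure $\sum_{i=1}^n v_i\delta_{a_i}$ on $F$, and a function $\psi$ on $F$ with its values $\psi(a_1),\dots,\psi(a_n)$; in this way $g'(u)$ is the function on $F$ with $g'(u)(a_i)=\partial_i g(u)$. Put $$W_2^2(u_d,u)=\inf\Big\{\int |x_1-x_2|^2\,\mathrm d\gamma(x_1,x_2)\;:\;\gamma\ge 0 \text{ a measure on } D\times F \text{ with marginals } u_d \text{ and } u\Big\}\in[0,\infty]$$ (with $\inf\emptyset=\infty$) and, for $\psi\colon F\to\mathbb R$, $\psi^c(x)=\min_{i}\big(|x-a_i|^2-\psi(a_i)\big)$. A vector $\bar u\in\mathbb R^n$ satisfies the *first-order condition* if $\psi=-2g'(\bar u)/\alpha$ fulfills $$\int_D\psi^c\,\mathrm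 du_d+\int_F\psi\,\mathrm d\bar u=W_2^2(u_d,\bar u).$$ For $\xi\in\mathbb R^n$ let $$D_i(\xi)=\{x\in\operatorname{int} D: a_i^\top x-\xi_i>a_j^\top x-\xi_j\ \text{for all } j\ne i\},\qquad \tilde u(\xi)=\big(u_d(D_1(\xi)),\dots,u_d(D_n(\xi))\big)^\top,$$ $$r(\xi)=A+\frac1\alpha\nabla g(\tilde u(\xi))-\xi,\qquad A=\frac12\big(|a_1|^2,\dots,|a_n|^2\big)^\top .$$ **Theorem (Optimality condition).** 1. For every $\bar u\in\mathbb R^n$ that satisfies the first-order condition there is a unique $\bar\xi\in\mathbb R^n$ with $\bar u=\tilde u(\bar\xi)$ and $r(\bar\xi)=0$. 2. Conversely, if $r(\bar\xi)=0$, then $\bar u:=\tilde u(\bar\xi)$ satisfies the first-order condition. 3. If $g$ is in addition convex, then $r$ has exactly one zero $\bar\xi\in\mathbb R^n$, and $\bar\xi$ is a global minimizer of $$\min_{\xi\in\mathbb R^n}\; g(\tilde u(\xi))+\frac\alpha2 W_2^2(u_d,\tilde u(\xi)).\tag{P$_\xi$}$$ -/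

import Mathlib

namespace SemiDiscreteOT

open MeasureTheory

/-- The Euclidean plane. -/
abbrev Plane : Type := EuclideanSpace ℝ (Fin 2)

/-- `ℝⁿ`, identified with the signed measures on `F = {a₁, …, aₙ}`. -/
abbrev Vec (n : ℕ) : Type := EuclideanSpace ℝ (Fin n)

/-- A full-dimensional convex compact polygon: the convex hull of finitely many points,
with nonempty interior. -/
def IsFullPolygon (D : Set Plane) : Prop :=
  (∃ s : Finset Plane, D = convexHull ℝ (s : Set Plane)) ∧ (interior D).Nonempty

/-- `ud` is a nonnegative measure on `D` whose Lebesgue density is continuous on `D`. -/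
def IsPrior (D : Set Plane) (ud : Measure Plane) : Prop :=
  ∃ ρ : Plane → ℝ, ContinuousOn ρ D ∧ (∀ x ∈ D, 0 ≤ ρ x) ∧
    ud = (volume.restrict D).withDensity (fun x => ENNReal.ofReal (ρ x))

noncomputable section

variable {n : ℕ}

/-- The signed measure `∑ i, v i • δ_{a i}` that the vector `v` stands for. -/
def discreteMeasure (a : Fin n → Plane) (v : Vec n) : SignedMeasure Plane :=
  ∑ i, v i • (Measure.dirac (a i)).toSignedMeasure

/-- Couplings of `ud` and `∑ i, v i • δ_{a i}`: nonnegative finite measures with these marginals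
(being concentrated on `D × F` is a consequence of the marginals). There are none
unless `v ≥ 0` and the total masses agree. -/
def couplings (a : Fin n → Plane) (ud : Measure Plane) (v : Vec n) :
    Set (FiniteMeasure (Plane × Plane)) :=
  {γ | (γ : Measure (Plane × Plane)).map Prod.fst = ud ∧
    ((γ : Measure (Plane × Plane)).map Prod.snd).toSignedMeasure = discreteMeasure a v}

/-- The squared quadratic Monge–Kantorovich distance between `ud` and `∑ i, v i • δ_{a i}`;
it is `∞` if there is no coupling. -/
def W2sq (a : Fin n → Plane) (ud : Measure Plane) (v : Vec n) : ENNReal :=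
  ⨅ γ ∈ couplings a ud v, ∫⁻ p, ‖p.1 - p.2‖ₑ ^ 2 ∂(γ : Measure (Plane × Plane))

/-- The `c`-conjugate, for `c(x, y) = |x - y|²`, of the function on `F` with values
`ψ i` at `a i`. -/
def cConj (a : Fin n → Plane) (ψ : Fin n → ℝ) (x : Plane) : ℝ :=
  ⨅ i, (‖x - a i‖ ^ 2 - ψ i)

/-- `ψ` is a Kantorovich potential: `∫_D ψᶜ dud + ∫_F ψ du = W₂²(ud, u)`,
as an equality of extended reals. -/
def IsKantorovichPotential (a : Fin n → Plane) (ud : Measure Plane) (u : Vec n)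
    (ψ : Fin n → ℝ) : Prop :=
  (((∫ x, cConj a ψ x ∂ud) + ∑ i, ψ i * u i : ℝ) : EReal) = (W2sq a ud u : EReal)

/-- The derivative `g'(u)` as a function on `F`: its value at `a i` is the derivative of `g`
in the direction of `δ_{a i}`. -/
def derivOnF (g : Vec n → ℝ) (u : Vec n) (i : Fin n) : ℝ :=
  fderiv ℝ g u (EuclideanSpace.single i 1)

/-- The first-order condition: `-2 g'(u) / α` is a Kantorovich potential for `(ud, u)`. -/
def FirstOrderCondition (a : Fin n → Plane) (ud : Measure Plane) (g : Vec n → ℝ) (α : ℝ)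
    (u : Vec n) : Prop :=
  IsKantorovichPotential a ud u (fun i => -2 * derivOnF g u i / α)

/-- The dominating region `D_i(ξ)`. -/
def region (a : Fin n → Plane) (D : Set Plane) (ξ : Vec n) (i : Fin n) : Set Plane :=
  {x ∈ interior D | ∀ j, j ≠ i → inner ℝ (a j) x - ξ j < inner ℝ (a i) x - ξ i}

/-- The vector `ũ(ξ)` of the masses `ud(D_i(ξ))`. -/
def uTilde (a : Fin n → Plane) (D : Set Plane) (ud : Measure Plane) (ξ : Vec n) : Vec n :=
  WithLp.toLp 2 (fun i => ud.real (region a D ξ i))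

/-- The vector `A = ½ (|a₁|², …, |aₙ|²)`. -/
def vecA (a : Fin n → Plane) : Vec n :=
  WithLp.toLp 2 (fun i => ‖a i‖ ^ 2 / 2)

/-- The residual `r(ξ) = A + (1/α) ∇g(ũ(ξ)) - ξ`. -/
def residual (a : Fin n → Plane) (D : Set Plane) (ud : Measure Plane) (g : Vec n → ℝ) (α : ℝ)
    (ξ : Vec n) : Vec n :=
  vecA a + (1 / α) • gradient g (uTilde a D ud ξ) - ξ

/-- The objective `g(ũ(ξ)) + (α/2) W₂²(ud, ũ(ξ))` of the problem over the weights `ξ`. -/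
def objXi (a : Fin n → Plane) (D : Set Plane) (ud : Measure Plane) (g : Vec n → ℝ) (α : ℝ)
    (ξ : Vec n) : EReal :=
  (g (uTilde a D ud ξ) : EReal) + ((α / 2 : ℝ) : EReal) * (W2sq a ud (uTilde a D ud ξ) : EReal)

end

end SemiDiscreteOT

namespace SemiDiscreteOT

open MeasureTheory Filter Topology

/-! The substitution `ξ = A - ψ / 2` (`weights`) identifies weights with potentials. In these terms
`r(ξ) = 0` says that `ξ` is fixed by weights ∘ potential ∘ `ũ`, and the first-order condition says
that `u` is fixed by `ũ` ∘ weights ∘ potential, so parts 1 and 2 become formal.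

The second equivalence is `isKantorovichPotential_iff`. The dual functional with target `u` is
concave with supergradient `u - ũ` (`dualValue_le`), and `ũ` is continuous in the potential because
ties between cells are null sets, so maximizers are exactly the `ψ` with `ũ = u`. Sending each cell
to its centre attains the dual value, which closes the duality gap (`W2sq_uTilde`).

For part 3, `g + (α / 2) * dualSup` is lower semicontinuous on the compact mass simplex. A minimizer
exists there and satisfies the first-order condition (`eq_uTilde_of_isMinOn`). Convexity of `g`
enters through monotonicity of its gradient and gives uniqueness. -/

/-! ### Null sets of the prior -/

theorem IsFullPolygon.convex {D : Set Plane} (hD : IsFullPolygon D) : Convex ℝ D := by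
  obtain ⟨⟨s, rfl⟩, -⟩ := hD
  exact convex_convexHull ℝ _

theorem IsFullPolygon.isCompact {D : Set Plane} (hD : IsFullPolygon D) : IsCompact D := by
  obtain ⟨⟨s, rfl⟩, -⟩ := hD
  exact s.finite_toSet.isCompact_convexHull (𝕜 := ℝ)

theorem IsPrior.isFiniteMeasure {D : Set Plane} {ud : Measure Plane} (hud : IsPrior D ud)
    (hD : IsCompact D) : IsFiniteMeasure ud := by
  obtain ⟨ρ, hρ, -, rfl⟩ := hud
  exact isFiniteMeasure_withDensity_ofReal (hρ.integrableOn_compact hD).2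

theorem IsPrior.absolutelyContinuous {D : Set Plane} {ud : Measure Plane}
    (hud : IsPrior D ud) : ud ≪ volume := by
  obtain ⟨ρ, -, -, rfl⟩ := hud
  exact (withDensity_absolutelyContinuous _ _).trans Measure.absolutelyContinuous_restrict

theorem IsPrior.ae_mem_interior {D : Set Plane} {ud : Measure Plane} (hud : IsPrior D ud)
    (hD : IsCompact D) (hconv : Convex ℝ D) : ∀ᵐ x ∂ud, x ∈ interior D := by
  have hfr : ∀ᵐ x ∂ud, x ∉ frontier D :=
    hud.absolutelyContinuous.ae_le (measure_eq_zero_iff_ae_notMem.1 (hconv.addHaar_frontier volume))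
  have hmem : ∀ᵐ x ∂ud, x ∈ D := by
    obtain ⟨ρ, -, -, rfl⟩ := hud
    exact (withDensity_absolutelyContinuous _ _).ae_le (ae_restrict_mem hD.measurableSet)
  filter_upwards [hfr, hmem] with x h1 h2
  by_contra h3
  exact h1 ⟨subset_closure h2, h3⟩

/-- A level set of a nonzero linear functional is a Lebesgue null set. -/
theorem volume_inner_eq_const {b : Plane} (hb : b ≠ 0) (t : ℝ) :
    volume {x : Plane | inner ℝ b x = t} = 0 := by
  rcases Set.eq_empty_or_nonempty {x : Plane | inner ℝ b x = t} with h | ⟨p, hp⟩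
  · simp [h]
  · let s : AffineSubspace ℝ Plane := AffineSubspace.mk' p (innerₛₗ ℝ b).ker
    have hs : s ≠ ⊤ := by
      intro h
      -- Membership of `p + b` would force `⟪b, b⟫ = 0`.
      have h1 : p + b ∈ s := h ▸ AffineSubspace.mem_top ℝ Plane _
      rw [AffineSubspace.mem_mk'] at h1
      simp at h1
      exact hb h1
    refine measure_mono_null (fun x hx => ?_) (Measure.addHaar_affineSubspace volume s hs)
    change x ∈ s
    rw [AffineSubspace.mem_mk', LinearMap.mem_ker]
    simp only [Set.mem_ofPred_eq] at hp hx
    simp [inner_sub_right, hp, hx]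

/-! ### Potentials, cells and the dual problem -/

noncomputable section

variable {n : ℕ}

/-- The weights `ξ = A - ψ / 2` that correspond to the potential `ψ`. -/
def weights (a : Fin n → Plane) (ψ : Fin n → ℝ) : Vec n :=
  WithLp.toLp 2 (fun i => ‖a i‖ ^ 2 / 2 - ψ i / 2)

/-- The cell on which the minimum in `ψᶜ` is attained at `i` only. -/
def cell (a : Fin n → Plane) (D : Set Plane) (ψ : Fin n → ℝ) (i : Fin n) : Set Plane :=
  region a D (weights a ψ) i

/-- The Kantorovich dual functional. -/
def dualValue (a : Fin n → Plane) (ud : Measure Plane) (u : Vec n) (ψ : Fin n → ℝ) : ℝ :=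
  (∫ x, cConj a ψ x ∂ud) + ∑ i, ψ i * u i

/-- The potential `-2 g'(u) / α` of the first-order condition. -/
def potential (g : Vec n → ℝ) (α : ℝ) (u : Vec n) (i : Fin n) : ℝ :=
  -2 * derivOnF g u i / α

/-- The value of the Kantorovich dual problem with target `u`. -/
def dualSup (a : Fin n → Plane) (ud : Measure Plane) (u : Vec n) : ℝ :=
  ⨆ ψ, dualValue a ud u ψ

/-- The vectors of nonnegative masses with the same total mass as `ud`. -/
def massSimplex (n : ℕ) (ud : Measure Plane) : Set (Vec n) :=
  {u | (∀ i, 0 ≤ u i) ∧ ∑ i, u i = ud.real Set.univ}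

end

variable {n : ℕ} {a : Fin n → Plane} {D : Set Plane} {ud : Measure Plane}

/-- Expanding the squares, `|x|²` cancels and twice the linear comparison of `region` remains. -/
theorem mem_cell {ψ : Fin n → ℝ} {i : Fin n} {x : Plane} :
    x ∈ cell a D ψ i ↔
      x ∈ interior D ∧ ∀ j, j ≠ i → ‖x - a i‖ ^ 2 - ψ i < ‖x - a j‖ ^ 2 - ψ j := by
  simp only [cell, region, weights, Set.mem_ofPred_eq]
  refine and_congr_right fun _ => forall_congr' fun j => imp_congr_right fun _ => ?_
  rw [norm_sub_sq_real, norm_sub_sq_real, real_inner_comm x, real_inner_comm x]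
  constructor <;> intro h <;> linarith

theorem cConj_le (ψ : Fin n → ℝ) (x : Plane) (i : Fin n) :
    cConj a ψ x ≤ ‖x - a i‖ ^ 2 - ψ i :=
  ciInf_le (Set.finite_range _).bddBelow i

theorem cConj_eq_of_mem_cell {ψ : Fin n → ℝ} {i : Fin n} {x : Plane} (hx : x ∈ cell a D ψ i) :
    cConj a ψ x = ‖x - a i‖ ^ 2 - ψ i := by
  have : Nonempty (Fin n) := ⟨i⟩
  refine le_antisymm (cConj_le ψ x i) (le_ciInf fun j => ?_)
  by_cases h : j = i
  · rw [h]
  · exact ((mem_cell.1 hx).2 j h).le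

theorem isOpen_cell (ψ : Fin n → ℝ) (i : Fin n) : IsOpen (cell a D ψ i) := by
  have : cell a D ψ i = interior D ∩ ⋂ j : Fin n, ⋂ _ : j ≠ i,
      {x | ‖x - a i‖ ^ 2 - ψ i < ‖x - a j‖ ^ 2 - ψ j} := by
    ext x
    simp [mem_cell]
  rw [this]
  refine isOpen_interior.inter (isOpen_iInter_of_finite fun j => isOpen_iInter_of_finite fun _ => ?_)
  exact isOpen_lt (by fun_prop) (by fun_prop)

theorem measurableSet_cell (ψ : Fin n → ℝ) (i : Fin n) : MeasurableSet (cell a D ψ i) :=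
  (isOpen_cell ψ i).measurableSet

theorem pairwise_disjoint_cell (ψ : Fin n → ℝ) :
    Pairwise (Function.onFun Disjoint (cell a D ψ)) := by
  intro i j hij
  refine Set.disjoint_left.2 fun x hi hj => ?_
  exact lt_asymm ((mem_cell.1 hi).2 j hij.symm) ((mem_cell.1 hj).2 i hij)

/-- A tie between `i` and `j` confines `x` to a line with normal `a i - a j ≠ 0`. -/
theorem ae_ne_of_ne (ha : Function.Injective a) (hac : ud ≪ volume) (ψ : Fin n → ℝ) :
    ∀ᵐ x ∂ud, ∀ i j, i ≠ j → ‖x - a i‖ ^ 2 - ψ i ≠ ‖x - a j‖ ^ 2 - ψ j := by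
  refine ae_all_iff.2 fun i => ae_all_iff.2 fun j => ?_
  by_cases hij : i = j
  · simp [hij]
  have h0 : a i - a j ≠ 0 := sub_ne_zero.2 (ha.ne hij)
  have := hac.ae_le (measure_eq_zero_iff_ae_notMem.1
    (volume_inner_eq_const h0 ((‖a i‖ ^ 2 - ψ i - (‖a j‖ ^ 2 - ψ j)) / 2)))
  filter_upwards [this] with x hx _ h
  apply hx
  rw [norm_sub_sq_real, norm_sub_sq_real, real_inner_comm, real_inner_comm (a j)] at h
  rw [inner_sub_left]
  linarith

theorem ae_exists_mem_cell [NeZero n] (ha : Function.Injective a) (hac : ud ≪ volume)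
    (hint : ∀ᵐ x ∂ud, x ∈ interior D) (ψ : Fin n → ℝ) :
    ∀ᵐ x ∂ud, ∃ i, x ∈ cell a D ψ i := by
  filter_upwards [ae_ne_of_ne ha hac ψ, hint] with x hne hx
  obtain ⟨i, hi⟩ := Finite.exists_min (fun i => ‖x - a i‖ ^ 2 - ψ i)
  exact ⟨i, mem_cell.2 ⟨hx, fun j hj => (hi j).lt_of_ne (hne i j hj.symm)⟩⟩

theorem sum_restrict_cell [NeZero n] (ha : Function.Injective a) (hac : ud ≪ volume)
    (hint : ∀ᵐ x ∂ud, x ∈ interior D) (ψ : Fin n → ℝ) :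
    ∑ i, ud.restrict (cell a D ψ i) = ud := by
  rw [← Measure.sum_fintype, ← Measure.restrict_iUnion (pairwise_disjoint_cell ψ)
    (measurableSet_cell ψ)]
  refine Measure.restrict_eq_self_of_ae_mem ?_
  filter_upwards [ae_exists_mem_cell ha hac hint ψ] with x hx
  exact Set.mem_iUnion.2 hx

theorem uTilde_weights (ψ : Fin n → ℝ) (i : Fin n) :
    uTilde a D ud (weights a ψ) i = ud.real (cell a D ψ i) := rfl

theorem continuous_cConj [NeZero n] (ψ : Fin n → ℝ) : Continuous (cConj a ψ) := by
  have : cConj a ψ = fun x => Finset.univ.inf' Finset.univ_nonempty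
      (fun i => ‖x - a i‖ ^ 2 - ψ i) := by
    ext x
    rw [Finset.inf'_univ_eq_ciInf]
    rfl
  rw [this]
  exact Continuous.finset_inf'_apply _ fun i _ => by fun_prop

theorem integrable_of_continuous [IsFiniteMeasure ud] (hD : IsCompact D)
    (hint : ∀ᵐ x ∂ud, x ∈ interior D) {f : Plane → ℝ} (hf : Continuous f) :
    Integrable f ud := by
  rw [← Measure.restrict_eq_self_of_ae_mem (hint.mono fun x hx => interior_subset hx)]
  exact hf.continuousOn.integrableOn_compact hD

theorem integrable_cConj [NeZero n] [IsFiniteMeasure ud] (hD : IsCompact D)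
    (hint : ∀ᵐ x ∂ud, x ∈ interior D) (ψ : Fin n → ℝ) : Integrable (cConj a ψ) ud :=
  integrable_of_continuous hD hint (continuous_cConj ψ)

theorem integral_eq_sum_cell [NeZero n] (ha : Function.Injective a) (hac : ud ≪ volume)
    (hint : ∀ᵐ x ∂ud, x ∈ interior D) (ψ : Fin n → ℝ) {f : Plane → ℝ} (hf : Integrable f ud) :
    ∫ x, f x ∂ud = ∑ i, ∫ x in cell a D ψ i, f x ∂ud := by
  conv_lhs => rw [← sum_restrict_cell ha hac hint ψ]
  exact integral_finsetSum_measure fun i _ => hf.restrict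

/-! ### Supergradients and maximizers of the dual functional -/

/-- The concave function `φ ↦ ∫ φᶜ` has the supergradient `-ũ` at `ψ`. -/
theorem integral_cConj_le [NeZero n] [IsFiniteMeasure ud] (ha : Function.Injective a)
    (hac : ud ≪ volume) (hD : IsCompact D) (hint : ∀ᵐ x ∂ud, x ∈ interior D)
    (φ ψ : Fin n → ℝ) :
    ∫ x, cConj a φ x ∂ud ≤
      ∫ x, cConj a ψ x ∂ud + ∑ i, (ψ i - φ i) * uTilde a D ud (weights a ψ) i := by
  rw [integral_eq_sum_cell ha hac hint ψ (integrable_cConj hD hint φ),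
    integral_eq_sum_cell ha hac hint ψ (integrable_cConj hD hint ψ), ← Finset.sum_add_distrib]
  refine Finset.sum_le_sum fun i _ => ?_
  have h1 : (ψ i - φ i) * uTilde a D ud (weights a ψ) i =
      ∫ x in cell a D ψ i, (ψ i - φ i) ∂ud := by
    rw [setIntegral_const, uTilde_weights, smul_eq_mul, mul_comm]
  rw [h1, ← integral_add (integrable_cConj hD hint ψ).restrict (integrable_const _)]
  refine setIntegral_mono_on (integrable_cConj hD hint φ).restrict
    ((integrable_cConj hD hint ψ).restrict.add (integrable_const _)) (measurableSet_cell ψ i)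
    fun x hx => ?_
  have h2 := cConj_le (a := a) φ x i
  rw [cConj_eq_of_mem_cell hx]
  linarith

theorem dualValue_le [NeZero n] [IsFiniteMeasure ud] (ha : Function.Injective a)
    (hac : ud ≪ volume) (hD : IsCompact D) (hint : ∀ᵐ x ∂ud, x ∈ interior D)
    (u : Vec n) (φ ψ : Fin n → ℝ) :
    dualValue a ud u φ ≤
      dualValue a ud u ψ + ∑ i, (ψ i - φ i) * (uTilde a D ud (weights a ψ) i - u i) := by
  have h := integral_cConj_le ha hac hD hint φ ψ
  have h1 : ∑ i, (ψ i - φ i) * (uTilde a D ud (weights a ψ) i - u i) =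
      ∑ i, (ψ i - φ i) * uTilde a D ud (weights a ψ) i
        - ∑ i, ψ i * u i + ∑ i, φ i * u i := by
    rw [← Finset.sum_sub_distrib, ← Finset.sum_add_distrib]
    exact Finset.sum_congr rfl fun i _ => by ring
  rw [dualValue, dualValue, h1]
  linarith

/-- The potential `ψ` is optimal for the dual problem with target `ũ(A - ψ / 2)`. -/
theorem dualValue_uTilde_le [NeZero n] [IsFiniteMeasure ud] (ha : Function.Injective a)
    (hac : ud ≪ volume) (hD : IsCompact D) (hint : ∀ᵐ x ∂ud, x ∈ interior D)
    (φ ψ : Fin n → ℝ) :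
    dualValue a ud (uTilde a D ud (weights a ψ)) φ ≤
      dualValue a ud (uTilde a D ud (weights a ψ)) ψ := by
  simpa using dualValue_le ha hac hD hint (uTilde a D ud (weights a ψ)) φ ψ

/-- Away from ties, membership of a fixed point in a cell is stable under small changes of the
potential. Hence the indicators converge almost everywhere, and so do the masses. -/
theorem tendsto_uTilde_weights [IsFiniteMeasure ud] (ha : Function.Injective a)
    (hac : ud ≪ volume) {ι : Type*} {l : Filter ι} [l.IsCountablyGenerated]
    {φ : ι → Fin n → ℝ} {ψ : Fin n → ℝ} (h : Tendsto φ l (𝓝 ψ)) (i : Fin n) :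
    Tendsto (fun k => uTilde a D ud (weights a (φ k)) i) l
      (𝓝 (uTilde a D ud (weights a ψ) i)) := by
  refine (ENNReal.tendsto_toReal (measure_ne_top ud _)).comp ?_
  refine tendsto_measure_of_ae_tendsto_indicator_of_isFiniteMeasure l (measurableSet_cell ψ i)
    (fun k => measurableSet_cell (φ k) i) ?_
  have hφ (j : Fin n) : Tendsto (fun k => φ k j) l (𝓝 (ψ j)) := (tendsto_pi_nhds.1 h) j
  filter_upwards [ae_ne_of_ne ha hac ψ] with x hx
  have hj : ∀ j, j ≠ i → ∀ᶠ k in l, (‖x - a i‖ ^ 2 - φ k i < ‖x - a j‖ ^ 2 - φ k j ↔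
      ‖x - a i‖ ^ 2 - ψ i < ‖x - a j‖ ^ 2 - ψ j) := by
    intro j hji
    have hi := (tendsto_const_nhds (x := ‖x - a i‖ ^ 2)).sub (hφ i)
    have hj := (tendsto_const_nhds (x := ‖x - a j‖ ^ 2)).sub (hφ j)
    rcases (hx i j hji.symm).lt_or_gt with hlt | hlt
    · filter_upwards [hi.eventually_lt hj hlt] with k hk
      exact iff_of_true hk hlt
    · filter_upwards [hj.eventually_lt hi hlt] with k hk
      exact iff_of_false hk.not_gt hlt.not_gt
  have hall := eventually_all.2 fun j => eventually_imp_distrib_left.2 (hj j)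
  filter_upwards [hall] with k hk
  change x ∈ cell a D (φ k) i ↔ x ∈ cell a D ψ i
  rw [mem_cell, mem_cell]
  exact and_congr_right fun _ => forall_congr' fun j => imp_congr_right fun hji => hk j hji

/-- A maximizer of the dual functional determines the target measure. -/
theorem eq_uTilde_of_isMax [NeZero n] [IsFiniteMeasure ud] (ha : Function.Injective a)
    (hac : ud ≪ volume) (hD : IsCompact D) (hint : ∀ᵐ x ∂ud, x ∈ interior D)
    {u : Vec n} {ψ : Fin n → ℝ} (hmax : ∀ φ, dualValue a ud u φ ≤ dualValue a ud u ψ) :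
    u = uTilde a D ud (weights a ψ) := by
  ext i
  -- The supergradient is taken at the perturbed potential, not at `ψ`. Both signs of `t` then bound
  -- `u i`, and continuity of `ũ` closes the gap as `t → 0`.
  have key : ∀ t : ℝ,
      0 ≤ t * (uTilde a D ud (weights a (ψ + t • Pi.single i 1)) i - u i) := by
    intro t
    have h1 := dualValue_le ha hac hD hint u ψ (ψ + t • Pi.single i 1)
    have h2 := hmax (ψ + t • Pi.single i 1)
    have h3 : ∑ j, ((ψ + t • Pi.single i 1 : Fin n → ℝ) j - ψ j) *
        (uTilde a D ud (weights a (ψ + t • Pi.single i 1)) j - u j) =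
        t * (uTilde a D ud (weights a (ψ + t • Pi.single i 1)) i - u i) := by
      rw [Finset.sum_eq_single i]
      · simp
      · intro j _ hj
        simp [hj]
      · simp
    linarith
  have hlim (s : Set ℝ) : Tendsto
      (fun t : ℝ => uTilde a D ud (weights a (ψ + t • Pi.single i (1 : ℝ))) i) (𝓝[s] 0)
      (𝓝 (uTilde a D ud (weights a ψ) i)) := by
    refine tendsto_uTilde_weights ha hac ?_ i
    have : Continuous fun t : ℝ => ψ + t • (Pi.single i (1 : ℝ) : Fin n → ℝ) := by fun_prop
    simpa using (this.tendsto 0).mono_left nhdsWithin_le_nhds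
  refine le_antisymm (ge_of_tendsto (hlim (Set.Ioi 0)) ?_) (le_of_tendsto (hlim (Set.Iio 0)) ?_)
  · filter_upwards [self_mem_nhdsWithin] with t ht
    exact sub_nonneg.1 (nonneg_of_mul_nonneg_right (key t) ht)
  · filter_upwards [self_mem_nhdsWithin] with t ht
    have := key t
    by_contra! hlt
    nlinarith [mul_neg_of_neg_of_pos (show t < 0 from ht) (sub_pos.2 hlt)]

/-! ### Weak duality and the optimal plan -/

theorem discreteMeasure_apply (v : Vec n) {B : Set Plane} (hB : MeasurableSet B) :
    discreteMeasure a v B = ∑ i, v i * B.indicator 1 (a i) := by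
  rw [discreteMeasure, sum_apply]
  refine Finset.sum_congr rfl fun i _ => ?_
  rw [_root_.smul_apply, Measure.toSignedMeasure_apply_measurable hB, smul_eq_mul,
    measureReal_def, Measure.dirac_apply' _ hB]
  by_cases h : a i ∈ B <;> simp [h]

theorem real_singleton_of_toSignedMeasure_eq (ha : Function.Injective a) {ν : Measure Plane}
    [IsFiniteMeasure ν] {v : Vec n} (h : ν.toSignedMeasure = discreteMeasure a v) (i : Fin n) :
    ν.real {a i} = v i := by
  rw [← Measure.toSignedMeasure_apply_measurable (measurableSet_singleton _), h,
    discreteMeasure_apply v (measurableSet_singleton _), Finset.sum_eq_single i]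
  · simp
  · intro j _ hj
    simp [ha.ne hj]
  · simp

theorem ae_mem_range_of_toSignedMeasure_eq {ν : Measure Plane}
    [IsFiniteMeasure ν] {v : Vec n} (h : ν.toSignedMeasure = discreteMeasure a v) :
    ∀ᵐ y ∂ν, y ∈ Set.range a := by
  have hm : MeasurableSet (Set.range a)ᶜ := (Set.finite_range a).measurableSet.compl
  change ν (Set.range a)ᶜ = 0
  rw [← measureReal_eq_zero_iff, ← Measure.toSignedMeasure_apply_measurable hm, h,
    discreteMeasure_apply v hm]
  simp

/-- Weak duality, for a single coupling. -/
theorem ofReal_dualValue_le_lintegral [NeZero n] [IsFiniteMeasure ud]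
    (ha : Function.Injective a) (hD : IsCompact D) (hint : ∀ᵐ x ∂ud, x ∈ interior D)
    (ψ : Fin n → ℝ) {u : Vec n} {γ : FiniteMeasure (Plane × Plane)} (hγ : γ ∈ couplings a ud u) :
    ENNReal.ofReal (dualValue a ud u ψ) ≤
      ∫⁻ p, ‖p.1 - p.2‖ₑ ^ 2 ∂(γ : Measure (Plane × Plane)) := by
  obtain ⟨hfst, hsnd⟩ := hγ
  set μ : Measure (Plane × Plane) := (γ : Measure (Plane × Plane))
  -- Extension by zero off `F`; the second marginal is concentrated on `F`, so the values elsewhere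
  -- do not matter.
  let ψ' : Plane → ℝ := fun y => ∑ i, ({a i} : Set Plane).indicator (fun _ => ψ i) y
  have hψ' (i : Fin n) : ψ' (a i) = ψ i := by
    simp only [ψ']
    rw [Finset.sum_eq_single i]
    · simp
    · intro j _ hj
      simp [ha.ne hj.symm]
    · simp
  have hsing (i : Fin n) : Integrable (({a i} : Set Plane).indicator (fun _ => ψ i))
      (μ.map Prod.snd) := (integrable_const _).indicator (measurableSet_singleton _)
  have hψint : Integrable ψ' (μ.map Prod.snd) := integrable_finsetSum _ fun i _ => hsing i
  have hψval : ∫ y, ψ' y ∂(μ.map Prod.snd) = ∑ i, ψ i * u i := by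
    rw [integral_finsetSum _ fun i _ => hsing i]
    refine Finset.sum_congr rfl fun i _ => ?_
    rw [integral_indicator_const _ (measurableSet_singleton _),
      real_singleton_of_toSignedMeasure_eq ha hsnd, smul_eq_mul, mul_comm]
  have hcint : Integrable (cConj a ψ) (μ.map Prod.fst) := by
    rw [hfst]
    exact integrable_cConj hD hint ψ
  have hi1 : Integrable (fun p : Plane × Plane => cConj a ψ p.1) μ :=
    hcint.comp_measurable measurable_fst
  have hi2 : Integrable (fun p : Plane × Plane => ψ' p.2) μ :=
    hψint.comp_measurable measurable_snd
  have hval : dualValue a ud u ψ = ∫ p, (cConj a ψ p.1 + ψ' p.2) ∂μ := by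
    rw [integral_add hi1 hi2, dualValue, ← hψval,
      integral_map measurable_snd.aemeasurable hψint.aestronglyMeasurable, ← hfst,
      integral_map measurable_fst.aemeasurable hcint.aestronglyMeasurable]
  have hle : ∀ᵐ p ∂μ, cConj a ψ p.1 + ψ' p.2 ≤ ‖p.1 - p.2‖ ^ 2 := by
    filter_upwards [ae_of_ae_map measurable_snd.aemeasurable
      (ae_mem_range_of_toSignedMeasure_eq hsnd)] with p hp
    obtain ⟨i, hi⟩ := hp
    have := cConj_le (a := a) ψ p.1 i
    rw [← hi, hψ']
    linarith
  -- The positive part allows passage to the lower Lebesgue integral; it remains below the cost,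
  -- which is nonnegative.
  have hpos : dualValue a ud u ψ ≤ ∫ p, max (cConj a ψ p.1 + ψ' p.2) 0 ∂μ := by
    rw [hval]
    exact integral_mono (hi1.add hi2) (hi1.add hi2).pos_part fun p => le_max_left _ _
  calc ENNReal.ofReal (dualValue a ud u ψ)
      ≤ ENNReal.ofReal (∫ p, max (cConj a ψ p.1 + ψ' p.2) 0 ∂μ) := ENNReal.ofReal_le_ofReal hpos
    _ = ∫⁻ p, ENNReal.ofReal (max (cConj a ψ p.1 + ψ' p.2) 0) ∂μ :=
        ofReal_integral_eq_lintegral_ofReal (hi1.add hi2).pos_part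
          (ae_of_all _ fun p => le_max_right _ _)
    _ ≤ ∫⁻ p, ‖p.1 - p.2‖ₑ ^ 2 ∂μ := by
        refine lintegral_mono_ae ?_
        filter_upwards [hle] with p hp
        rw [← ofReal_norm, ← ENNReal.ofReal_pow (norm_nonneg _)]
        exact ENNReal.ofReal_le_ofReal (max_le hp (sq_nonneg _))

theorem ofReal_dualValue_le_W2sq [NeZero n] [IsFiniteMeasure ud]
    (ha : Function.Injective a) (hD : IsCompact D) (hint : ∀ᵐ x ∂ud, x ∈ interior D)
    (ψ : Fin n → ℝ) (u : Vec n) :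
    ENNReal.ofReal (dualValue a ud u ψ) ≤ W2sq a ud u :=
  le_iInf₂ fun _ hγ => ofReal_dualValue_le_lintegral ha hD hint ψ hγ

theorem dualValue_uTilde_eq_sum [NeZero n] [IsFiniteMeasure ud] (ha : Function.Injective a)
    (hac : ud ≪ volume) (hD : IsCompact D) (hint : ∀ᵐ x ∂ud, x ∈ interior D)
    (ψ : Fin n → ℝ) :
    dualValue a ud (uTilde a D ud (weights a ψ)) ψ =
      ∑ i, ∫ x in cell a D ψ i, ‖x - a i‖ ^ 2 ∂ud := by
  rw [dualValue, integral_eq_sum_cell ha hac hint ψ (integrable_cConj hD hint ψ),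
    ← Finset.sum_add_distrib]
  refine Finset.sum_congr rfl fun i _ => ?_
  have h1 : ψ i * uTilde a D ud (weights a ψ) i = ∫ x in cell a D ψ i, ψ i ∂ud := by
    rw [setIntegral_const, uTilde_weights, smul_eq_mul, mul_comm]
  rw [h1, ← integral_add (integrable_cConj hD hint ψ).restrict (integrable_const _)]
  refine setIntegral_congr_fun (measurableSet_cell ψ i) fun x hx => ?_
  simp [cConj_eq_of_mem_cell hx]

theorem dualValue_uTilde_nonneg [NeZero n] [IsFiniteMeasure ud] (ha : Function.Injective a)
    (hac : ud ≪ volume) (hD : IsCompact D) (hint : ∀ᵐ x ∂ud, x ∈ interior D)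
    (ψ : Fin n → ℝ) : 0 ≤ dualValue a ud (uTilde a D ud (weights a ψ)) ψ := by
  rw [dualValue_uTilde_eq_sum ha hac hD hint ψ]
  exact Finset.sum_nonneg fun i _ => integral_nonneg fun x => sq_nonneg _

/-- The transport plan that sends each cell to its centre is admissible, and its cost is the
dual value of `ψ`. -/
theorem W2sq_uTilde_le [NeZero n] [IsFiniteMeasure ud] (ha : Function.Injective a)
    (hac : ud ≪ volume) (hD : IsCompact D) (hint : ∀ᵐ x ∂ud, x ∈ interior D)
    (ψ : Fin n → ℝ) :
    W2sq a ud (uTilde a D ud (weights a ψ)) ≤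
      ENNReal.ofReal (dualValue a ud (uTilde a D ud (weights a ψ)) ψ) := by
  have hpair (i : Fin n) : Measurable fun x : Plane => (x, a i) := by fun_prop
  let μ : Measure (Plane × Plane) :=
    ∑ i, (ud.restrict (cell a D ψ i)).map fun x => (x, a i)
  have hμfin : IsFiniteMeasure μ := by
    simp only [μ]
    infer_instance
  have hfst : μ.map Prod.fst = ud := by
    conv_rhs => rw [← sum_restrict_cell ha hac hint ψ]
    simp only [μ]
    rw [← Measure.mapₗ_apply_of_measurable measurable_fst, map_sum]
    refine Finset.sum_congr rfl fun i _ => ?_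
    rw [Measure.mapₗ_apply_of_measurable measurable_fst,
      Measure.map_map measurable_fst (hpair i)]
    exact Measure.map_id
  have hsnd : (μ.map Prod.snd).toSignedMeasure =
      discreteMeasure a (uTilde a D ud (weights a ψ)) := by
    ext B hB
    rw [Measure.toSignedMeasure_apply_measurable hB, discreteMeasure_apply _ hB,
      map_measureReal_apply measurable_snd hB]
    simp only [μ, measureReal_def, Measure.finsetSum_apply]
    rw [ENNReal.toReal_sum fun i _ => measure_ne_top _ _]
    refine Finset.sum_congr rfl fun i _ => ?_
    rw [Measure.map_apply (hpair i) (measurable_snd hB), uTilde_weights]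
    by_cases h : a i ∈ B <;> simp [h, Set.preimage_preimage, measureReal_def]
  refine (iInf₂_le (⟨μ, hμfin⟩ : FiniteMeasure (Plane × Plane)) ⟨hfst, hsnd⟩).trans ?_
  change ∫⁻ p, ‖p.1 - p.2‖ₑ ^ 2 ∂μ ≤ _
  rw [dualValue_uTilde_eq_sum ha hac hD hint ψ,
    ENNReal.ofReal_sum_of_nonneg fun i _ => integral_nonneg fun x => sq_nonneg _]
  simp only [μ]
  rw [lintegral_finsetSum_measure]
  refine Finset.sum_le_sum fun i _ => ?_
  rw [lintegral_map (by fun_prop) (hpair i), ofReal_integral_eq_lintegral_ofReal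
    (integrable_of_continuous hD hint (by fun_prop)).restrict (ae_of_all _ fun x => sq_nonneg _)]
  refine lintegral_mono fun x => ?_
  rw [ENNReal.ofReal_pow (norm_nonneg _), ofReal_norm]

theorem W2sq_uTilde [NeZero n] [IsFiniteMeasure ud] (ha : Function.Injective a)
    (hac : ud ≪ volume) (hD : IsCompact D) (hint : ∀ᵐ x ∂ud, x ∈ interior D)
    (ψ : Fin n → ℝ) :
    (W2sq a ud (uTilde a D ud (weights a ψ)) : EReal) =
      (dualValue a ud (uTilde a D ud (weights a ψ)) ψ : EReal) := by
  rw [(W2sq_uTilde_le ha hac hD hint ψ).antisymm (ofReal_dualValue_le_W2sq ha hD hint ψ _),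
    EReal.coe_ennreal_ofReal, max_eq_left (dualValue_uTilde_nonneg ha hac hD hint ψ)]

/-- The Kantorovich potentials for the target `u` are the `ψ` whose cells have the masses `u`. -/
theorem isKantorovichPotential_iff [NeZero n] [IsFiniteMeasure ud] (ha : Function.Injective a)
    (hac : ud ≪ volume) (hD : IsCompact D) (hint : ∀ᵐ x ∂ud, x ∈ interior D)
    {u : Vec n} {ψ : Fin n → ℝ} :
    IsKantorovichPotential a ud u ψ ↔ u = uTilde a D ud (weights a ψ) := by
  constructor
  · intro h
    refine eq_uTilde_of_isMax ha hac hD hint fun φ => ?_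
    -- Weak duality for every `φ`: equality at `ψ` makes `ψ` a dual maximizer.
    have h1 : ((dualValue a ud u φ : ℝ) : EReal) ≤ (W2sq a ud u : EReal) := by
      refine le_trans ?_ (EReal.coe_ennreal_le_coe_ennreal_iff.2
        (ofReal_dualValue_le_W2sq ha hD hint φ u))
      rw [EReal.coe_ennreal_ofReal]
      exact EReal.coe_le_coe_iff.2 (le_max_left _ _)
    rw [← h] at h1
    exact EReal.coe_le_coe_iff.1 h1
  · rintro rfl
    exact (W2sq_uTilde ha hac hD hint ψ).symm

/-! ### Fixed-point forms of the two conditions -/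

theorem gradient_apply_eq_derivOnF (g : Vec n → ℝ) (u : Vec n) (i : Fin n) :
    gradient g u i = derivOnF g u i := by
  rw [derivOnF, ← inner_gradient_left, EuclideanSpace.inner_single_right]
  simp

theorem fderiv_eq_sum_derivOnF (g : Vec n → ℝ) (u v : Vec n) :
    fderiv ℝ g u v = ∑ i, derivOnF g u i * v i := by
  rw [← inner_gradient_left, PiLp.inner_apply]
  refine Finset.sum_congr rfl fun i _ => ?_
  rw [← gradient_apply_eq_derivOnF]
  simp [mul_comm]

theorem sum_potential_mul (g : Vec n → ℝ) (α : ℝ) (u v : Vec n) :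
    ∑ i, potential g α u i * v i = -2 / α * fderiv ℝ g u v := by
  rw [fderiv_eq_sum_derivOnF, Finset.mul_sum]
  exact Finset.sum_congr rfl fun i _ => by rw [potential]; ring

theorem residual_eq_zero_iff {g : Vec n → ℝ} {α : ℝ} {ξ : Vec n} :
    residual a D ud g α ξ = 0 ↔ ξ = weights a (potential g α (uTilde a D ud ξ)) := by
  have : vecA a + (1 / α) • gradient g (uTilde a D ud ξ) =
      weights a (potential g α (uTilde a D ud ξ)) := by
    ext i
    simp only [vecA, weights, potential, PiLp.add_apply, PiLp.smul_apply,
      gradient_apply_eq_derivOnF, smul_eq_mul]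
    ring
  rw [residual, this, sub_eq_zero, eq_comm]

theorem firstOrderCondition_iff [NeZero n] [IsFiniteMeasure ud] (ha : Function.Injective a)
    (hac : ud ≪ volume) (hD : IsCompact D) (hint : ∀ᵐ x ∂ud, x ∈ interior D)
    {g : Vec n → ℝ} {α : ℝ} {u : Vec n} :
    FirstOrderCondition a ud g α u ↔ u = uTilde a D ud (weights a (potential g α u)) :=
  isKantorovichPotential_iff ha hac hD hint

/-! ### Convexity and minimization over the mass simplex -/

/-- The gradient of a convex function is monotone. -/
theorem fderiv_sub_nonneg_of_convexOn {E : Type*} [NormedAddCommGroup E] [NormedSpace ℝ E]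
    {g : E → ℝ} (hg : Differentiable ℝ g) (hconv : ConvexOn ℝ Set.univ g) (u v : E) :
    0 ≤ fderiv ℝ g u (u - v) - fderiv ℝ g v (u - v) := by
  have key (x y : E) : fderiv ℝ g x (y - x) ≤ g y - g x := by
    have hd : HasDerivAt (fun t : ℝ => g (AffineMap.lineMap x y t)) (fderiv ℝ g x (y - x)) 0 := by
      have h1 : HasFDerivAt g (fderiv ℝ g x) (AffineMap.lineMap x y (0 : ℝ)) := by
        simpa using (hg x).hasFDerivAt
      exact h1.comp_hasDerivAt 0 AffineMap.hasDerivAt_lineMap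
    have hc : ConvexOn ℝ Set.univ (fun t : ℝ => g (AffineMap.lineMap x y t)) :=
      hconv.comp_affineMap (AffineMap.lineMap x y)
    have := hc.le_slope_of_hasDerivAt (Set.mem_univ 0) (Set.mem_univ 1) zero_lt_one hd
    simpa [slope_def_field] using this
  have h1 := key u v
  have h2 := key v u
  rw [← neg_sub u v, map_neg] at h1
  linarith

/-- The conjugate term does not involve the target, so a change of target contributes only a linear
term. -/
theorem dualValue_add_sub (u v : Vec n) (ψ : Fin n → ℝ) :
    dualValue a ud u ψ = dualValue a ud v ψ + ∑ i, ψ i * (u - v) i := by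
  simp only [dualValue, PiLp.sub_apply, mul_sub, Finset.sum_sub_distrib]
  ring

theorem isCompact_massSimplex : IsCompact (massSimplex n ud) := by
  refine Metric.isCompact_of_isClosed_isBounded ?_ ?_
  · have : massSimplex n ud = (⋂ i, {u : Vec n | 0 ≤ u i}) ∩
        {u : Vec n | ∑ i, u i = ud.real Set.univ} := by
      ext u
      simp [massSimplex]
    rw [this]
    exact (isClosed_iInter fun i => isClosed_le (by fun_prop) (by fun_prop)).inter
      (isClosed_eq (by fun_prop) (by fun_prop))
  · refine (Metric.isBounded_iff_subset_closedBall (0 : Vec n)).2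
      ⟨ud.real Set.univ, fun u hu => ?_⟩
    rw [mem_closedBall_zero_iff, ← hu.2, EuclideanSpace.norm_eq]
    refine Real.sqrt_le_iff.2 ⟨Finset.sum_nonneg fun i _ => hu.1 i, ?_⟩
    simpa [Real.norm_eq_abs, sq_abs] using
      Finset.sum_sq_le_sq_sum_of_nonneg (s := Finset.univ) (f := fun i => u i) fun i _ => hu.1 i

theorem convex_massSimplex : Convex ℝ (massSimplex n ud) := by
  intro u hu v hv s t hs ht hst
  refine ⟨fun i => ?_, ?_⟩
  · exact add_nonneg (mul_nonneg hs (hu.1 i)) (mul_nonneg ht (hv.1 i))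
  · simp only [PiLp.add_apply, PiLp.smul_apply, smul_eq_mul, Finset.sum_add_distrib,
      ← Finset.mul_sum, hu.2, hv.2]
    rw [← add_mul, hst, one_mul]

theorem uTilde_mem_massSimplex [NeZero n] [IsFiniteMeasure ud] (ha : Function.Injective a)
    (hac : ud ≪ volume) (hint : ∀ᵐ x ∂ud, x ∈ interior D) (ψ : Fin n → ℝ) :
    uTilde a D ud (weights a ψ) ∈ massSimplex n ud := by
  refine ⟨fun i => measureReal_nonneg, ?_⟩
  conv_rhs => rw [← sum_restrict_cell ha hac hint ψ]
  simp only [measureReal_def, Measure.finsetSum_apply, uTilde_weights]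
  rw [ENNReal.toReal_sum fun i _ => measure_ne_top _ _]
  simp

theorem bddAbove_range_dualValue [NeZero n] [IsFiniteMeasure ud] (hD : IsCompact D)
    (hint : ∀ᵐ x ∂ud, x ∈ interior D) {u : Vec n} (hu : u ∈ massSimplex n ud) :
    BddAbove (Set.range (dualValue a ud u)) := by
  have hcont (i : Fin n) : Integrable (fun x => ‖x - a i‖ ^ 2) ud :=
    integrable_of_continuous hD hint (by fun_prop)
  refine ⟨∑ i, ∫ x, ‖x - a i‖ ^ 2 ∂ud, ?_⟩
  rintro _ ⟨ψ, rfl⟩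
  -- At a maximal `ψ i`, the loss `-ψ i` in `ψᶜ` compensates the linear term, because the total
  -- masses agree.
  obtain ⟨i, hi⟩ := Finite.exists_max ψ
  have h1 : ∫ x, cConj a ψ x ∂ud ≤ ∫ x, (‖x - a i‖ ^ 2 - ψ i) ∂ud :=
    integral_mono (integrable_cConj hD hint ψ) ((hcont i).sub (integrable_const _))
      fun x => cConj_le ψ x i
  rw [integral_sub (hcont i) (integrable_const _), integral_const, smul_eq_mul] at h1
  have h2 : ∑ j, ψ j * u j ≤ ud.real Set.univ * ψ i := by
    rw [← hu.2, Finset.sum_mul]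
    exact Finset.sum_le_sum fun j _ => by
      rw [mul_comm]
      exact mul_le_mul_of_nonneg_left (hi j) (hu.1 j)
  have h3 : ∫ x, ‖x - a i‖ ^ 2 ∂ud ≤ ∑ i, ∫ x, ‖x - a i‖ ^ 2 ∂ud :=
    Finset.single_le_sum (f := fun i => ∫ x, ‖x - a i‖ ^ 2 ∂ud)
      (fun j _ => integral_nonneg fun x => sq_nonneg _) (Finset.mem_univ i)
  rw [dualValue]
  linarith

/-- A supremum of functions that are continuous and affine in the target. -/
theorem lowerSemicontinuousOn_dualSup [NeZero n] [IsFiniteMeasure ud] (hD : IsCompact D)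
    (hint : ∀ᵐ x ∂ud, x ∈ interior D) :
    LowerSemicontinuousOn (dualSup a ud) (massSimplex n ud) := by
  refine lowerSemicontinuousOn_ciSup (fun u hu => bddAbove_range_dualValue hD hint hu) fun ψ => ?_
  refine Continuous.lowerSemicontinuous ?_ |>.lowerSemicontinuousOn _
  unfold dualValue
  fun_prop

theorem convexOn_dualSup [NeZero n] [IsFiniteMeasure ud] (hD : IsCompact D)
    (hint : ∀ᵐ x ∂ud, x ∈ interior D) :
    ConvexOn ℝ (massSimplex n ud) (dualSup a ud) := by
  refine ⟨convex_massSimplex, fun u hu v hv s t hs ht hst => ciSup_le fun ψ => ?_⟩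
  have h : dualValue a ud (s • u + t • v) ψ =
      s * dualValue a ud u ψ + t * dualValue a ud v ψ := by
    have : ∑ i, ψ i * (s • u + t • v) i = s * ∑ i, ψ i * u i + t * ∑ i, ψ i * v i := by
      rw [Finset.mul_sum, Finset.mul_sum, ← Finset.sum_add_distrib]
      refine Finset.sum_congr rfl fun i _ => ?_
      simp only [PiLp.add_apply, PiLp.smul_apply, smul_eq_mul]
      ring
    simp only [dualValue, this]
    linear_combination (-(∫ x, cConj a ψ x ∂ud)) * hst
  rw [h]
  exact add_le_add
    (mul_le_mul_of_nonneg_left (le_ciSup (bddAbove_range_dualValue hD hint hu) ψ) hs)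
    (mul_le_mul_of_nonneg_left (le_ciSup (bddAbove_range_dualValue hD hint hv) ψ) ht)

theorem dualSup_uTilde [NeZero n] [IsFiniteMeasure ud] (ha : Function.Injective a)
    (hac : ud ≪ volume) (hD : IsCompact D) (hint : ∀ᵐ x ∂ud, x ∈ interior D)
    (ψ : Fin n → ℝ) :
    dualSup a ud (uTilde a D ud (weights a ψ)) =
      dualValue a ud (uTilde a D ud (weights a ψ)) ψ :=
  le_antisymm (ciSup_le fun φ => dualValue_uTilde_le ha hac hD hint φ ψ)
    (le_ciSup (bddAbove_range_dualValue hD hint (uTilde_mem_massSimplex ha hac hint ψ)) ψ)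

/-- First-order necessary condition for a minimizer of the sum of a differentiable and a
convex function. -/
theorem fderiv_add_sub_nonneg_of_isMinOn {E : Type*} [NormedAddCommGroup E] [NormedSpace ℝ E]
    {s : Set E} {g h : E → ℝ} (hg : Differentiable ℝ g) (hh : ConvexOn ℝ s h) {u v : E}
    (hu : u ∈ s) (hv : v ∈ s) (hmin : IsMinOn (fun w => g w + h w) s u) :
    0 ≤ fderiv ℝ g u (v - u) + (h v - h u) := by
  -- `h` is replaced by its chord, which lies above it and agrees at `u`. So `0` still minimizes,
  -- and `φ` is differentiable there.
  let φ : ℝ → ℝ := fun t => g (AffineMap.lineMap u v t) + t * (h v - h u)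
  have hd : HasDerivAt φ (fderiv ℝ g u (v - u) + (h v - h u)) 0 := by
    have h1 : HasFDerivAt g (fderiv ℝ g u) (AffineMap.lineMap u v (0 : ℝ)) := by
      simpa using (hg u).hasFDerivAt
    exact (h1.comp_hasDerivAt 0 AffineMap.hasDerivAt_lineMap).add
      (by simpa using (hasDerivAt_id (0 : ℝ)).mul_const (h v - h u))
  have hmin' : IsMinOn φ (Set.Icc 0 1) 0 := by
    intro t ht
    have h1 : (1 - t) • u + t • v ∈ s :=
      hh.1 hu hv (sub_nonneg.2 ht.2) ht.1 (by ring)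
    have h2 := hmin h1
    have h3 := hh.2 hu hv (sub_nonneg.2 ht.2) ht.1 (by ring)
    simp only [Set.mem_ofPred_eq, smul_eq_mul] at h2 h3
    simp only [φ, Set.mem_ofPred_eq, AffineMap.lineMap_apply_module]
    simp only [sub_zero, one_smul, zero_smul, add_zero, zero_mul]
    linarith
  have hcone : (1 : ℝ) ∈ posTangentConeAt (Set.Icc (0 : ℝ) 1) 0 := by
    simpa using sub_mem_posTangentConeAt_of_segment_subset
      (segment_eq_Icc (zero_le_one' ℝ)).subset
  simpa using hmin'.localize.hasFDerivWithinAt_nonneg hd.hasFDerivAt.hasFDerivWithinAt hcone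

theorem weights_surjective (a : Fin n → Plane) : Function.Surjective (weights a) := by
  intro ξ
  refine ⟨fun i => ‖a i‖ ^ 2 - 2 * ξ i, ?_⟩
  ext i
  simp only [weights]
  ring

/-- A minimizer of `g + (α / 2) W₂²` over the mass simplex satisfies the first-order
condition. -/
theorem eq_uTilde_of_isMinOn [NeZero n] [IsFiniteMeasure ud] (ha : Function.Injective a)
    (hac : ud ≪ volume) (hD : IsCompact D) (hint : ∀ᵐ x ∂ud, x ∈ interior D)
    {g : Vec n → ℝ} (hg : Differentiable ℝ g) {α : ℝ} (hα : 0 < α) {u : Vec n}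
    (hu : u ∈ massSimplex n ud)
    (hmin : IsMinOn (fun w => g w + α / 2 * dualSup a ud w) (massSimplex n ud) u) :
    u = uTilde a D ud (weights a (potential g α u)) := by
  set ψ := potential g α u
  -- This competitor is chosen because `ψ` is dual optimal for it. In the variational inequality the
  -- derivative of `g` then cancels, leaving optimality of `ψ` for `u`.
  set v := uTilde a D ud (weights a ψ)
  have hv : v ∈ massSimplex n ud := uTilde_mem_massSimplex ha hac hint ψ
  have hfoc := fderiv_add_sub_nonneg_of_isMinOn hg
    ((convexOn_dualSup (a := a) hD hint).smul (by positivity : 0 ≤ α / 2)) hu hv hmin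
  have hpot : ∑ i, ψ i * (v - u) i = -2 / α * fderiv ℝ g u (v - u) := sum_potential_mul g α u _
  have hsup : dualSup a ud u ≤ dualValue a ud u ψ := by
    have h1 : dualSup a ud v = dualValue a ud v ψ := dualSup_uTilde ha hac hD hint ψ
    rw [h1, dualValue_add_sub v u ψ, hpot] at hfoc
    simp only [smul_eq_mul] at hfoc
    have h2 : fderiv ℝ g u (v - u) + (α / 2 * (dualValue a ud u ψ + -2 / α *
        fderiv ℝ g u (v - u)) - α / 2 * dualSup a ud u) =
        α / 2 * (dualValue a ud u ψ - dualSup a ud u) := by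
      field_simp
      ring
    rw [h2] at hfoc
    exact sub_nonneg.1 (nonneg_of_mul_nonneg_right hfoc (by positivity))
  exact eq_uTilde_of_isMax ha hac hD hint fun φ =>
    (le_ciSup (bddAbove_range_dualValue hD hint hu) φ).trans hsup

theorem objXi_weights [NeZero n] [IsFiniteMeasure ud] (ha : Function.Injective a)
    (hac : ud ≪ volume) (hD : IsCompact D) (hint : ∀ᵐ x ∂ud, x ∈ interior D)
    (g : Vec n → ℝ) (α : ℝ) (ψ : Fin n → ℝ) :
    objXi a D ud g α (weights a ψ) =
      ((g (uTilde a D ud (weights a ψ)) +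
        α / 2 * dualSup a ud (uTilde a D ud (weights a ψ)) : ℝ) : EReal) := by
  rw [objXi, W2sq_uTilde ha hac hD hint ψ, dualSup_uTilde ha hac hD hint ψ, EReal.coe_add,
    EReal.coe_mul]

theorem exists_residual_eq_zero_and_isMin [NeZero n] [IsFiniteMeasure ud]
    (ha : Function.Injective a) (hac : ud ≪ volume) (hD : IsCompact D)
    (hint : ∀ᵐ x ∂ud, x ∈ interior D) {g : Vec n → ℝ} (hg : Differentiable ℝ g)
    {α : ℝ} (hα : 0 < α) :
    ∃ ξ, residual a D ud g α ξ = 0 ∧ ∀ ξ', objXi a D ud g α ξ ≤ objXi a D ud g α ξ' := by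
  have hne : (massSimplex n ud).Nonempty := ⟨_, uTilde_mem_massSimplex ha hac hint 0⟩
  have hlsc : LowerSemicontinuousOn (fun w => g w + α / 2 * dualSup a ud w)
      (massSimplex n ud) := by
    refine (hg.continuous.lowerSemicontinuous.lowerSemicontinuousOn _).add ?_
    exact (Continuous.comp_lowerSemicontinuousOn (g := fun t : ℝ => α / 2 * t) (by fun_prop)
      (lowerSemicontinuousOn_dualSup hD hint)
      fun s t hst => mul_le_mul_of_nonneg_left hst (by positivity))
  obtain ⟨u, hu, hmin⟩ := hlsc.exists_isMinOn hne isCompact_massSimplex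
  have heq := eq_uTilde_of_isMinOn ha hac hD hint hg hα hu hmin
  -- `heq` says that `ũ` of these weights is `u` again.
  refine ⟨weights a (potential g α u), residual_eq_zero_iff.2 (by rw [← heq]), fun ξ' => ?_⟩
  obtain ⟨φ, rfl⟩ := weights_surjective a ξ'
  rw [objXi_weights ha hac hD hint, objXi_weights ha hac hD hint, ← heq]
  exact EReal.coe_le_coe_iff.2 (hmin (uTilde_mem_massSimplex ha hac hint φ))

/-- Gradient monotonicity makes the potential of `u` dual optimal for `v` as well. A maximizer
determines its target, so `v = u`, and the zeros are recovered from these masses. -/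
theorem eq_of_residual_eq_zero [NeZero n] [IsFiniteMeasure ud]
    (ha : Function.Injective a) (hac : ud ≪ volume) (hD : IsCompact D)
    (hint : ∀ᵐ x ∂ud, x ∈ interior D) {g : Vec n → ℝ} (hg : Differentiable ℝ g)
    (hconv : ConvexOn ℝ Set.univ g) {α : ℝ} (hα : 0 < α) {ξ ξ' : Vec n}
    (hξ : residual a D ud g α ξ = 0) (hξ' : residual a D ud g α ξ' = 0) : ξ' = ξ := by
  rw [residual_eq_zero_iff] at hξ hξ'
  set u := uTilde a D ud ξ
  set v := uTilde a D ud ξ'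
  have hu' : u = uTilde a D ud (weights a (potential g α u)) := by rw [← hξ]
  have hv' : v = uTilde a D ud (weights a (potential g α v)) := by rw [← hξ']
  have hmaxu (φ) : dualValue a ud u φ ≤ dualValue a ud u (potential g α u) := by
    have := dualValue_uTilde_le ha hac hD hint φ (potential g α u)
    rwa [← hu'] at this
  have hmaxv (φ) : dualValue a ud v φ ≤ dualValue a ud v (potential g α v) := by
    have := dualValue_uTilde_le ha hac hD hint φ (potential g α v)
    rwa [← hv'] at this
  -- Passing from target `u` to `v` changes the gap between the two potentials by a multiple of the
  -- monotonicity expression, whose sign is favourable.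
  have hle : dualValue a ud v (potential g α v) ≤ dualValue a ud v (potential g α u) := by
    have h1 := hmaxu (potential g α v)
    have h2 := dualValue_add_sub (a := a) (ud := ud) u v (potential g α u)
    have h3 := dualValue_add_sub (a := a) (ud := ud) u v (potential g α v)
    rw [sum_potential_mul] at h2 h3
    have h4 := mul_nonneg (by positivity : 0 ≤ 2 / α) (fderiv_sub_nonneg_of_convexOn hg hconv u v)
    have h5 : 2 / α * (fderiv ℝ g u (u - v) - fderiv ℝ g v (u - v)) =
        -2 / α * fderiv ℝ g v (u - v) - -2 / α * fderiv ℝ g u (u - v) := by ring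
    linarith
  have huv : v = u := by
    rw [hu']
    exact eq_uTilde_of_isMax ha hac hD hint fun φ => (hmaxv φ).trans hle
  rw [hξ, hξ', huv]

end SemiDiscreteOT

/-! ### Assembly -/

theorem mainTheorem1 {n : ℕ} (hn : 0 < n)
    (a : Fin n → SemiDiscreteOT.Plane) (ha : Function.Injective a)
    (D : Set SemiDiscreteOT.Plane) (hD : SemiDiscreteOT.IsFullPolygon D)
    (ud : MeasureTheory.Measure SemiDiscreteOT.Plane) (hud : SemiDiscreteOT.IsPrior D ud)
    (g : SemiDiscreteOT.Vec n → ℝ) (hg : ContDiff ℝ 2 g)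
    (α : ℝ) (hα : 0 < α) :
    (∀ u : SemiDiscreteOT.Vec n, SemiDiscreteOT.FirstOrderCondition a ud g α u →
      ∃! ξ : SemiDiscreteOT.Vec n,
        u = SemiDiscreteOT.uTilde a D ud ξ ∧ SemiDiscreteOT.residual a D ud g α ξ = 0) ∧
    (∀ ξ : SemiDiscreteOT.Vec n, SemiDiscreteOT.residual a D ud g α ξ = 0 →
      SemiDiscreteOT.FirstOrderCondition a ud g α (SemiDiscreteOT.uTilde a D ud ξ)) ∧
    (ConvexOn ℝ Set.univ g →
      ∃ ξ : SemiDiscreteOT.Vec n, SemiDiscreteOT.residual a D ud g α ξ = 0 ∧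
        (∀ ξ' : SemiDiscreteOT.Vec n, SemiDiscreteOT.residual a D ud g α ξ' = 0 → ξ' = ξ) ∧
        ∀ ξ' : SemiDiscreteOT.Vec n,
          SemiDiscreteOT.objXi a D ud g α ξ ≤ SemiDiscreteOT.objXi a D ud g α ξ') := by
  have : NeZero n := ⟨hn.ne'⟩
  have hcpt := hD.isCompact
  have hfin := hud.isFiniteMeasure hcpt
  have hac := hud.absolutelyContinuous
  have hint := hud.ae_mem_interior hcpt hD.convex
  have hdiff : Differentiable ℝ g := hg.differentiable (by norm_num)
  refine ⟨fun u hu => ?_, fun ξ hξ => ?_, fun hconv => ?_⟩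
  · rw [SemiDiscreteOT.firstOrderCondition_iff ha hac hcpt hint] at hu
    -- Unification with `hu` makes the witness the weights of the potential at `u`.
    refine ⟨_, ⟨hu, SemiDiscreteOT.residual_eq_zero_iff.2 (by rw [← hu])⟩, ?_⟩
    rintro ξ ⟨hξ, hres⟩
    rw [SemiDiscreteOT.residual_eq_zero_iff, ← hξ] at hres
    exact hres
  · rw [SemiDiscreteOT.firstOrderCondition_iff ha hac hcpt hint,
      ← SemiDiscreteOT.residual_eq_zero_iff.1 hξ]
  · obtain ⟨ξ, hξ, hmin⟩ :=
      SemiDiscreteOT.exists_residual_eq_zero_and_isMin ha hac hcpt hint hdiff hα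
    exact ⟨ξ, hξ, fun ξ' hξ' =>
      SemiDiscreteOT.eq_of_residual_eq_zero ha hac hcpt hint hdiff hconv hα hξ hξ', hmin⟩
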